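/- Let $X$ be a compact metrizable space and let $H(X)$ be the group of all homeomorphisms of $X$ onto itself under composition. Let $O_X$ be the set of points of $X$ that have a neighborhood homeomorphic to the open interval $(0,1)$, and let $C_X = X\setminus O_X$. Fix any metric $d$ compatible with the topology of $X$. For $\varepsilon>0$ and $C\subseteq X$ let $C_\varepsilon=\{x\in X : d(x,c)<\varepsilon \text{ for some } c\in C\}$ (so $C_\varepsilon=\emptyset$ if $C=\emptyset$), let $$B_\varepsilon=\{h\in H(X) : d(h(x),x)<\varepsilon \text{ and } d(h^{-1}(x),x)<\varepsilon \text{ for all } x\in X\setminus C_\varepsilon\},$$ and let $\tau_{k|C}$ (the compact-open topology shrunken around $C$) be the topology on $H(X)$ whose open sets are exactly the unions of left translates $gB_\varepsilon$ with $g\in H(X)$, $\varepsilon>0$. If $O_X$ is dense in $X$, then $\tau_{k|C_X}$ is the minimum Hausdorff group topology on $H(X)$; that is, $\tau_{k|C_X}$ is a Hausdorff topology that makes $H(X)$ a topological group, and every $\tau_{k|C_X}$-open set is open in every Hausdorff topology on $H(X)$ that makes $H(X)$ a topological group. -/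

import Mathlib

open Set Topology

namespace ShrunkenTopology

/-- The one-manifold part `O_X` of a space `X`: the points of `X` that have a neighborhood
homeomorphic to the open interval `(0, 1)`. -/
def oneManifoldPart (X : Type*) [TopologicalSpace X] : Set X :=
  {x | ∃ N ∈ 𝓝 x, Nonempty (N ≃ₜ Ioo (0 : ℝ) 1)}

section Shrunken

variable {X : Type*} [MetricSpace X]

/-- The set `B_ε` of all homeomorphisms `h` of `X` such that `d(h(x), x) < ε` and
`d(h⁻¹(x), x) < ε` for all `x ∈ X ∖ C_ε`. Here `C_ε = Metric.thickening ε C` is the set of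
points whose distance to `C` is less than `ε`; it is empty when `C` is empty. -/
def shrunkenBall (C : Set X) (ε : ℝ) : Set (X ≃ₜ X) :=
  {h | ∀ x, x ∉ Metric.thickening ε C → dist (h x) x < ε ∧ dist (h⁻¹ x) x < ε}

/-- The left translates `g B_ε` (for `g` in the homeomorphism group and `ε > 0`). -/
def shrunkenTranslates (C : Set X) : Set (Set (X ≃ₜ X)) :=
  {A | ∃ (g : X ≃ₜ X) (ε : ℝ), 0 < ε ∧ A = (fun h => g * h) '' shrunkenBall C ε}

theorem one_mem_shrunkenBall (C : Set X) {ε : ℝ} (hε : 0 < ε) :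
    (1 : X ≃ₜ X) ∈ shrunkenBall C ε := by
  intro x _
  have h1 : (1 : X ≃ₜ X) x = x := rfl
  simp [h1, hε]

theorem shrunkenBall_mono (C : Set X) {δ ε : ℝ} (h : δ ≤ ε) :
    shrunkenBall C δ ⊆ shrunkenBall C ε := by
  intro g hg x hx
  have := hg x (fun hx' => hx (Metric.thickening_mono h C hx'))
  exact ⟨this.1.trans_le h, this.2.trans_le h⟩

theorem exists_mul_subset_shrunkenBall [CompactSpace X] (C : Set X) {ε : ℝ} (hε : 0 < ε)
    {f : X ≃ₜ X} (hf : f ∈ shrunkenBall C ε) :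
    ∃ δ > 0, ∀ g ∈ shrunkenBall C δ, f * g ∈ shrunkenBall C ε := by
  obtain ⟨ε₁, h₁ε, h₁⟩ : ∃ ε₁ < ε, ∀ x, x ∉ Metric.thickening ε C →
      dist (f x) x ≤ ε₁ ∧ dist (f⁻¹ x) x ≤ ε₁ := by
    have hK : IsCompact (Metric.thickening ε C)ᶜ :=
      (Metric.isOpen_thickening.isClosed_compl).isCompact
    rcases (Metric.thickening ε C)ᶜ.eq_empty_or_nonempty with he | hne
    · refine ⟨0, hε, fun x hx => ?_⟩
      have : x ∈ (Metric.thickening ε C)ᶜ := hx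
      simp [he] at this
    · have hc : Continuous fun x => max (dist (f x) x) (dist (f⁻¹ x) x) :=
        (f.continuous.dist continuous_id).max ((f⁻¹).continuous.dist continuous_id)
      obtain ⟨y, hy, hmax⟩ := hK.exists_isMaxOn hne hc.continuousOn
      refine ⟨_, max_lt (hf y hy).1 (hf y hy).2, fun x hx => ?_⟩
      exact max_le_iff.1 (hmax hx)
  obtain ⟨δ', hδ', hu⟩ := Metric.uniformContinuous_iff.1
    (CompactSpace.uniformContinuous_of_continuous f.continuous) (ε - ε₁) (sub_pos.2 h₁ε)
  by_cases hall : ∀ x, x ∈ Metric.thickening ε C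
  · exact ⟨1, one_pos, fun g _ x hx => absurd (hall x) hx⟩
  obtain ⟨x₀, hx₀⟩ := not_forall.1 hall
  have h₁0 : 0 ≤ ε₁ := dist_nonneg.trans (h₁ x₀ hx₀).1
  refine ⟨min δ' (ε - ε₁), lt_min hδ' (sub_pos.2 h₁ε), fun g hg x hx => ?_⟩
  have hfg : (f * g) x = f (g x) := rfl
  have hfg' : (f * g)⁻¹ x = g⁻¹ (f⁻¹ x) := rfl
  rw [hfg, hfg']
  have hb := h₁ x hx
  constructor
  · have hxδ : x ∉ Metric.thickening (min δ' (ε - ε₁)) C := fun h =>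
      hx (Metric.thickening_mono ((min_le_right _ _).trans (by linarith)) C h)
    have := hu ((hg x hxδ).1.trans_le (min_le_left _ _))
    have := dist_triangle (f (g x)) (f x) x
    linarith
  · have hxδ : f⁻¹ x ∉ Metric.thickening (min δ' (ε - ε₁)) C := by
      intro h
      obtain ⟨c, hc, hd⟩ := Metric.mem_thickening_iff.1 h
      refine hx (Metric.mem_thickening_iff.2 ⟨c, hc, ?_⟩)
      have h2 := hd.trans_le (min_le_right _ _)
      have h3 := dist_triangle_left x c (f⁻¹ x)
      linarith
    have h2 := (hg _ hxδ).2.trans_le (min_le_right _ _)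
    have := dist_triangle (g⁻¹ (f⁻¹ x)) (f⁻¹ x) x
    linarith

theorem sUnion_translates_iff [CompactSpace X] (C : Set X) (U : Set (X ≃ₜ X)) :
    (∃ S ⊆ shrunkenTranslates C, U = ⋃₀ S) ↔
      ∀ g ∈ U, ∃ δ > 0, ∀ h ∈ shrunkenBall C δ, g * h ∈ U := by
  constructor
  · rintro ⟨S, hS, rfl⟩ g ⟨A, hA, hgA⟩
    obtain ⟨k, ε, hε, rfl⟩ := hS hA
    obtain ⟨f, hf, rfl⟩ := hgA
    obtain ⟨δ, hδ, h⟩ := exists_mul_subset_shrunkenBall C hε hf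
    exact ⟨δ, hδ, fun g hg => ⟨_, hA, f * g, h g hg, (mul_assoc k f g).symm⟩⟩
  · intro hU
    refine ⟨{A | A ∈ shrunkenTranslates C ∧ A ⊆ U}, fun A hA => hA.1, ?_⟩
    refine Subset.antisymm (fun g hg => ?_) (sUnion_subset fun A hA => hA.2)
    obtain ⟨δ, hδ, h⟩ := hU g hg
    refine ⟨_, ⟨⟨g, δ, hδ, rfl⟩, ?_⟩, 1, one_mem_shrunkenBall C hδ, mul_one g⟩
    rintro _ ⟨k, hk, rfl⟩
    exact h k hk

/-- The compact-open topology shrunken around `C`, denoted `τ_{k|C}`: the open sets are exactly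
the unions of left translates of the sets `B_ε`, `ε > 0`. -/
@[reducible] def shrunkenTopology [CompactSpace X] (C : Set X) : TopologicalSpace (X ≃ₜ X) where
  IsOpen U := ∃ S ⊆ shrunkenTranslates C, U = ⋃₀ S
  isOpen_univ := (sUnion_translates_iff C _).2 fun _ _ => ⟨1, one_pos, fun _ _ => mem_univ _⟩
  isOpen_inter U V hU hV := by
    rw [sUnion_translates_iff] at hU hV ⊢
    rintro g ⟨hgU, hgV⟩
    obtain ⟨δ, hδ, h⟩ := hU g hgU
    obtain ⟨η, hη, h'⟩ := hV g hgV
    exact ⟨min δ η, lt_min hδ hη, fun k hk =>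
      ⟨h k (shrunkenBall_mono C (min_le_left _ _) hk),
        h' k (shrunkenBall_mono C (min_le_right _ _) hk)⟩⟩
  isOpen_sUnion 𝒰 h𝒰 := by
    rw [sUnion_translates_iff]
    rintro g ⟨U, hU, hgU⟩
    obtain ⟨δ, hδ, h⟩ := (sUnion_translates_iff C U).1 (h𝒰 U hU) g hgU
    exact ⟨δ, hδ, fun k hk => ⟨U, hU, h k hk⟩⟩

end Shrunken

/-- `τ` is a Hausdorff group topology on the group `G`. -/
def IsHausdorffGroupTopology {G : Type*} [Group G] (τ : TopologicalSpace G) : Prop :=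
  @IsTopologicalGroup G τ _ ∧ @T2Space G τ

/-- `τ` is the minimum Hausdorff group topology on `G`: it is a Hausdorff group topology, and
every set open in `τ` is open in every Hausdorff group topology on `G`. -/
def IsMinimumHausdorffGroupTopology {G : Type*} [Group G] (τ : TopologicalSpace G) : Prop :=
  IsHausdorffGroupTopology τ ∧
    ∀ σ : TopologicalSpace G, IsHausdorffGroupTopology σ →
      ∀ U : Set G, IsOpen[τ] U → IsOpen[σ] U

end ShrunkenTopology

/-!
Write `O` for the one-manifold part of `X` and `C` for its complement.

The sets `B_ε` form a neighborhood basis of `1` for a group topology: they are symmetric,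
`B_{ε/2} B_{ε/2} ⊆ B_ε`, and they are stable under conjugation up to shrinking because every
homeomorphism is uniformly continuous and preserves `C`. A homeomorphism lying in all `B_ε` fixes
the open set `O` pointwise, so density of `O` gives the Hausdorff property.

For minimality, let `σ` be a Hausdorff group topology on the homeomorphism group. If `f` and `g`
are non-commuting homeomorphisms supported in `U`, then `{h | h f h⁻¹ does not commute with g}` is
a `σ`-open neighborhood of `1`, and each of its members satisfies `h(U) ∩ U ≠ ∅`, as homeomorphisms
with disjoint supports commute (`eventually_exists_map_mem`). Such `f` and `g` exist for every open
arc `U ⊆ O`.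

Given `x ∈ O`, take four successive disjoint arcs inside a small open arc around `x`, two on each
side of `x`. A homeomorphism `h` close to `1` in `σ` sends some point of each of the four arcs into
the same arc. The image of the piece between the two middle points is connected, accumulates at the
images of these two points and avoids all four image points; this forces it into the small arc
(`image_Ioo_subset_of_four_points`). So `h` moves every point near `x` only a little, and
compactness of the complement of the `ε`-neighborhood of `C` puts `h` in `B_ε`.
-/

namespace ShrunkenTopology

open Filter

/-! ### The one-manifold part -/

section OneManifoldPart

variable {X : Type*} [TopologicalSpace X]

theorem isOpen_oneManifoldPart : IsOpen (oneManifoldPart X) := by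
  rw [isOpen_iff_mem_nhds]
  rintro x ⟨N, hN, he⟩
  filter_upwards [eventually_mem_nhds_iff.2 hN] with y hy using ⟨N, hy, he⟩

theorem map_mem_oneManifoldPart (g : X ≃ₜ X) {x : X} (hx : x ∈ oneManifoldPart X) :
    g x ∈ oneManifoldPart X := by
  obtain ⟨N, hN, ⟨e⟩⟩ := hx
  exact ⟨g '' N, g.isOpenMap.image_mem_nhds hN, ⟨(g.image N).symm.trans e⟩⟩

theorem map_mem_compl_oneManifoldPart (g : X ≃ₜ X) {x : X} (hx : x ∈ (oneManifoldPart X)ᶜ) :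
    g x ∈ (oneManifoldPart X)ᶜ := fun h =>
  hx (by simpa using map_mem_oneManifoldPart g⁻¹ h)

/-- Around a point of the one-manifold part there are arbitrarily small open arcs. The chart
neighborhood in the definition need not be open, so it is first cut down to an open set. -/
theorem exists_isOpenEmbedding_real {x : X} (hx : x ∈ oneManifoldPart X) {s : Set X}
    (hs : s ∈ 𝓝 x) : ∃ ψ : ℝ → X, IsOpenEmbedding ψ ∧ ψ 0 = x ∧ range ψ ⊆ s := by
  obtain ⟨N, hN, ⟨e⟩⟩ := hx
  let W : Set X := interior (N ∩ s)
  have hWN : W ⊆ N := interior_subset.trans inter_subset_left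
  have hxW : x ∈ W := mem_interior_iff_mem_nhds.2 (inter_mem hN hs)
  have hi : IsOpenEmbedding (inclusion hWN) :=
    IsOpenEmbedding.inclusion hWN (isOpen_interior.preimage continuous_subtype_val)
  let j : W → ℝ := fun w => (e (inclusion hWN w) : ℝ)
  have hj : IsOpenEmbedding j :=
    (isOpen_Ioo.isOpenEmbedding_subtypeVal.comp e.isOpenEmbedding).comp hi
  have : Nonempty W := ⟨⟨x, hxW⟩⟩
  obtain ⟨r, hr, hball⟩ := Metric.isOpen_iff.1 hj.isOpen_range (j ⟨x, hxW⟩) (mem_range_self _)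
  let E := hj.toOpenPartialHomeomorph j
  let B := OpenPartialHomeomorph.univBall (j ⟨x, hxW⟩) r
  let F : OpenPartialHomeomorph ℝ W := B.trans E.symm
  have hF : F.source = univ := by
    refine eq_univ_of_forall fun t => ?_
    have hB : t ∈ B.source := by simp [B]
    have : B t ∈ Metric.ball (j ⟨x, hxW⟩) r := by
      rw [← OpenPartialHomeomorph.univBall_target _ hr]
      exact B.map_source hB
    simp only [F, OpenPartialHomeomorph.trans_source, mem_inter_iff, mem_preimage]
    exact ⟨hB, by simpa [E] using hball this⟩
  refine ⟨fun t => (F t : X), isOpen_interior.isOpenEmbedding_subtypeVal.comp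
    (F.isOpenEmbedding hF), ?_, ?_⟩
  · have h0 : B 0 = E ⟨x, hxW⟩ := OpenPartialHomeomorph.univBall_apply_zero _ _
    have : F 0 = ⟨x, hxW⟩ := by
      change E.symm (B 0) = _
      rw [h0]
      exact E.left_inv (by simp [E])
    simp [this]
  · rintro _ ⟨t, rfl⟩
    exact (interior_subset (F t).2).2

end OneManifoldPart

/-! ### The shrunken topology is a Hausdorff group topology -/

section GroupTopology

variable {X : Type*} [MetricSpace X]

theorem inv_mem_shrunkenBall {C : Set X} {ε : ℝ} {h : X ≃ₜ X} (hh : h ∈ shrunkenBall C ε) :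
    h⁻¹ ∈ shrunkenBall C ε := fun x hx => by
  rw [inv_inv]
  exact (hh x hx).symm

theorem dist_mul_lt_of_mem_shrunkenBall {C : Set X} {ε : ℝ} {f g : X ≃ₜ X}
    (hf : f ∈ shrunkenBall C (ε / 2)) (hg : g ∈ shrunkenBall C (ε / 2)) {x : X}
    (hx : x ∉ Metric.thickening ε C) : dist ((f * g) x) x < ε := by
  have hε : 0 < ε := by
    by_contra h
    have hx' : x ∉ Metric.thickening (ε / 2) C := by
      simp [Metric.thickening_of_nonpos (show ε / 2 ≤ 0 by linarith)]
    have := (hg x hx').1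
    linarith [dist_nonneg (x := g x) (y := x)]
  have hgx := (hg x fun h => hx (Metric.thickening_mono (half_le_self hε.le) C h)).1
  have hfgx := (hf (g x) fun h => by
    obtain ⟨c, hc, hd⟩ := Metric.mem_thickening_iff.1 h
    refine hx (Metric.mem_thickening_iff.2 ⟨c, hc, ?_⟩)
    linarith [dist_triangle_left x c (g x)]).1
  have := dist_triangle (f (g x)) (g x) x
  rw [Homeomorph.mul_apply]
  linarith

theorem mul_mem_shrunkenBall {C : Set X} {ε : ℝ} {f g : X ≃ₜ X}
    (hf : f ∈ shrunkenBall C (ε / 2)) (hg : g ∈ shrunkenBall C (ε / 2)) :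
    f * g ∈ shrunkenBall C ε := fun x hx => by
  refine ⟨dist_mul_lt_of_mem_shrunkenBall hf hg hx, ?_⟩
  rw [mul_inv_rev]
  exact dist_mul_lt_of_mem_shrunkenBall (inv_mem_shrunkenBall hg) (inv_mem_shrunkenBall hf) hx

theorem exists_conj_mem_shrunkenBall [CompactSpace X] {C : Set X} {g : X ≃ₜ X}
    (hg : MapsTo g C C) {ε : ℝ} (hε : 0 < ε) :
    ∃ δ > 0, ∀ h ∈ shrunkenBall C δ, g * h * g⁻¹ ∈ shrunkenBall C ε := by
  obtain ⟨δ, hδ, hu⟩ := Metric.uniformContinuous_iff.1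
    (CompactSpace.uniformContinuous_of_continuous g.continuous) ε hε
  have key : ∀ h ∈ shrunkenBall C δ, ∀ x, x ∉ Metric.thickening ε C →
      dist ((g * h * g⁻¹) x) x < ε := by
    intro h hh x hx
    have hx' : g⁻¹ x ∉ Metric.thickening δ C := by
      intro hm
      obtain ⟨c, hc, hd⟩ := Metric.mem_thickening_iff.1 hm
      refine hx (Metric.mem_thickening_iff.2 ⟨g c, hg hc, ?_⟩)
      simpa using hu hd
    simpa using hu (hh _ hx').1
  refine ⟨δ, hδ, fun h hh x hx => ⟨key h hh x hx, ?_⟩⟩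
  have : (g * h * g⁻¹)⁻¹ = g * h⁻¹ * g⁻¹ := by group
  rw [this]
  exact key _ (inv_mem_shrunkenBall hh) x hx

theorem mem_nhds_shrunkenTopology_iff [CompactSpace X] {C : Set X} {g : X ≃ₜ X}
    {s : Set (X ≃ₜ X)} :
    s ∈ @nhds _ (shrunkenTopology C) g ↔ ∃ δ > 0, ∀ h ∈ shrunkenBall C δ, g * h ∈ s := by
  let := shrunkenTopology C
  rw [mem_nhds_iff]
  constructor
  · rintro ⟨U, hUs, hU, hgU⟩
    obtain ⟨δ, hδ, h⟩ := (sUnion_translates_iff C U).1 hU g hgU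
    exact ⟨δ, hδ, fun k hk => hUs (h k hk)⟩
  · rintro ⟨δ, hδ, h⟩
    refine ⟨(fun h => g * h) '' shrunkenBall C δ, ?_, ?_, 1, one_mem_shrunkenBall C hδ, mul_one g⟩
    · rintro _ ⟨k, hk, rfl⟩
      exact h k hk
    · exact ⟨{(fun h => g * h) '' shrunkenBall C δ},
        singleton_subset_iff.2 ⟨g, δ, hδ, rfl⟩, (sUnion_singleton _).symm⟩

theorem mem_nhds_one_shrunkenTopology_iff [CompactSpace X] {C : Set X} {s : Set (X ≃ₜ X)} :
    s ∈ @nhds _ (shrunkenTopology C) 1 ↔ ∃ δ > 0, shrunkenBall C δ ⊆ s := by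
  simp only [mem_nhds_shrunkenTopology_iff, one_mul]
  rfl

theorem isTopologicalGroup_shrunkenTopology [CompactSpace X] {C : Set X}
    (hC : ∀ g : X ≃ₜ X, MapsTo g C C) :
    @IsTopologicalGroup (X ≃ₜ X) (shrunkenTopology C) _ := by
  let := shrunkenTopology C
  refine IsTopologicalGroup.of_nhds_one ?_ ?_ ?_ ?_
  · intro s hs
    obtain ⟨ε, hε, h⟩ := mem_nhds_one_shrunkenTopology_iff.1 hs
    have hB : shrunkenBall C (ε / 2) ∈ 𝓝 (1 : X ≃ₜ X) :=
      mem_nhds_one_shrunkenTopology_iff.2 ⟨ε / 2, half_pos hε, Subset.rfl⟩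
    rw [mem_map]
    filter_upwards [prod_mem_prod hB hB] with p hp using h (mul_mem_shrunkenBall hp.1 hp.2)
  · intro s hs
    obtain ⟨ε, hε, h⟩ := mem_nhds_one_shrunkenTopology_iff.1 hs
    exact mem_nhds_one_shrunkenTopology_iff.2
      ⟨ε, hε, fun k hk => h (inv_mem_shrunkenBall hk)⟩
  · intro g
    ext s
    rw [mem_map, mem_nhds_shrunkenTopology_iff, mem_nhds_one_shrunkenTopology_iff]
    rfl
  · intro g s hs
    obtain ⟨ε, hε, h⟩ := mem_nhds_one_shrunkenTopology_iff.1 hs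
    obtain ⟨δ, hδ, h'⟩ := exists_conj_mem_shrunkenBall (hC g) hε
    exact mem_nhds_one_shrunkenTopology_iff.2 ⟨δ, hδ, fun k hk => h (h' k hk)⟩

theorem eq_of_forall_mem_shrunkenBall {C : Set X} (hC : IsClosed C) {h : X ≃ₜ X}
    (hh : ∀ ε > 0, h ∈ shrunkenBall C ε) {x : X} (hx : x ∉ C) : h x = x := by
  obtain ⟨r, hr, hball⟩ := Metric.isOpen_iff.1 hC.isOpen_compl x hx
  refine dist_le_zero.1 (le_of_forall_pos_lt_add fun ε hε => ?_)
  have hxr : x ∉ Metric.thickening (min r ε) C := fun hm => by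
    obtain ⟨c, hc, hd⟩ := Metric.mem_thickening_iff.1 hm
    exact hball (by rw [Metric.mem_ball, dist_comm]; exact hd.trans_le (min_le_left _ _)) hc
  rw [zero_add]
  exact (hh _ (lt_min hr hε) x hxr).1.trans_le (min_le_right _ _)

theorem isHausdorffGroupTopology_shrunkenTopology [CompactSpace X]
    (hO : Dense (oneManifoldPart X)) :
    IsHausdorffGroupTopology (shrunkenTopology (oneManifoldPart X)ᶜ) := by
  have hG := isTopologicalGroup_shrunkenTopology (C := (oneManifoldPart X)ᶜ)
    fun g _ => map_mem_compl_oneManifoldPart g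
  refine ⟨hG, ?_⟩
  let := shrunkenTopology (oneManifoldPart X)ᶜ
  refine IsTopologicalGroup.t2Space_of_one_sep fun h h1 => ?_
  by_contra hcon
  push Not at hcon
  refine h1 (Homeomorph.ext fun x => congrFun (h.continuous.ext_on hO continuous_id ?_) x)
  intro x hx
  refine eq_of_forall_mem_shrunkenBall isOpen_oneManifoldPart.isClosed_compl
    (fun ε hε => hcon _ ?_) (not_not.2 hx)
  exact mem_nhds_one_shrunkenTopology_iff.2 ⟨ε, hε, Subset.rfl⟩

end GroupTopology

/-! ### Non-commuting homeomorphisms supported in an arc -/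

/-- The homeomorphism `t ↦ t + d(t, ℝ ∖ (a, b)) / 2` of the line. Adding half of a `1`-Lipschitz
function to the identity keeps it strictly increasing. -/
theorem exists_homeomorph_real_lt {a b : ℝ} :
    ∃ φ : ℝ ≃ₜ ℝ, (∀ t ∉ Ioo a b, φ t = t) ∧ ∀ t ∈ Ioo a b, t < φ t := by
  let D : ℝ → ℝ := fun t => Metric.infDist t (Ioo a b)ᶜ
  let u : ℝ → ℝ := fun t => t + D t / 2
  have hcl : IsClosed (Ioo a b)ᶜ := isOpen_Ioo.isClosed_compl
  have hne : ((Ioo a b)ᶜ).Nonempty := ⟨a, by simp⟩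
  have hfix : ∀ t ∉ Ioo a b, u t = t := fun t ht => by
    simp [u, D, Metric.infDist_zero_of_mem (show t ∈ (Ioo a b)ᶜ from ht)]
  have hmono : StrictMono u := fun t s hts => by
    have h1 : D t ≤ D s + dist t s := Metric.infDist_le_infDist_add_dist
    rw [Real.dist_eq, abs_sub_comm, abs_of_pos (sub_pos.2 hts)] at h1
    simp only [u]
    linarith
  have hcont : Continuous u := by
    have : Continuous D := Metric.continuous_infDist_pt _
    fun_prop
  have hsurj : Function.Surjective u := by
    refine hcont.surjective ?_ ?_
    · refine tendsto_id.congr' ?_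
      filter_upwards [eventually_ge_atTop b] with t ht
      exact (hfix t fun h => absurd h.2 (not_lt.2 ht)).symm
    · refine tendsto_id.congr' ?_
      filter_upwards [eventually_le_atBot a] with t ht
      exact (hfix t fun h => absurd h.1 (not_lt.2 ht)).symm
  refine ⟨(hmono.orderIsoOfSurjective u hsurj).toHomeomorph, hfix, fun t ht => ?_⟩
  have : 0 < D t := (hcl.notMem_iff_infDist_pos hne).1 (not_not.2 ht)
  change t < t + D t / 2
  linarith

section Extension

variable {X : Type*} [TopologicalSpace X] [T2Space X]

theorem continuous_viaEmbedding {ψ : ℝ → X} (hψ : IsOpenEmbedding ψ) {a b : ℝ} {φ : ℝ ≃ₜ ℝ}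
    (hφ : ∀ t ∉ Ioo a b, φ t = t) :
    Continuous (Equiv.Perm.viaEmbedding φ.toEquiv ⟨ψ, hψ.injective⟩) := by
  set F := Equiv.Perm.viaEmbedding φ.toEquiv ⟨ψ, hψ.injective⟩
  have hF : ∀ t, F (ψ t) = ψ (φ t) := Equiv.Perm.viaEmbedding_apply φ.toEquiv ⟨ψ, hψ.injective⟩
  rw [continuous_iff_continuousAt]
  intro x
  by_cases hx : x ∈ range ψ
  · obtain ⟨t, rfl⟩ := hx
    rw [← hψ.continuousAt_iff]
    have : F ∘ ψ = ψ ∘ φ := funext hF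
    rw [this]
    exact (hψ.continuous.comp φ.continuous).continuousAt
  -- Outside the chart: `F` is the identity on the complement of the compact set `ψ '' Icc a b`.
  · have hopen : IsOpen (ψ '' Icc a b)ᶜ := (isCompact_Icc.image hψ.continuous).isClosed.isOpen_compl
    have hxm : x ∈ (ψ '' Icc a b)ᶜ := fun h => hx (image_subset_range _ _ h)
    refine continuousAt_id.congr ?_
    filter_upwards [hopen.mem_nhds hxm] with y hy
    by_cases hyr : y ∈ range ψ
    · obtain ⟨t, rfl⟩ := hyr
      rw [hF, hφ t fun h => hy (mem_image_of_mem _ (Ioo_subset_Icc_self h)), id]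
    · exact (Equiv.Perm.viaEmbedding_apply_of_notMem φ.toEquiv ⟨ψ, hψ.injective⟩ y hyr).symm

/-- A homeomorphism of the line supported in `(a, b)` extends along an open embedding of the line,
by the identity outside its range. -/
theorem exists_homeomorph_extension {ψ : ℝ → X} (hψ : IsOpenEmbedding ψ) {a b : ℝ} {φ : ℝ ≃ₜ ℝ}
    (hφ : ∀ t ∉ Ioo a b, φ t = t) :
    ∃ f : X ≃ₜ X, (∀ t, f (ψ t) = ψ (φ t)) ∧ ∀ x ∉ ψ '' Ioo a b, f x = x := by
  have hφ' : ∀ t ∉ Ioo a b, φ.symm t = t := fun t ht => by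
    rw [Homeomorph.symm_apply_eq, hφ t ht]
  let f : X ≃ₜ X :=
    { toEquiv := Equiv.Perm.viaEmbedding φ.toEquiv ⟨ψ, hψ.injective⟩
      continuous_toFun := continuous_viaEmbedding hψ hφ
      continuous_invFun := by
        have h : (Equiv.Perm.viaEmbedding φ.toEquiv ⟨ψ, hψ.injective⟩)⁻¹ =
            Equiv.Perm.viaEmbedding φ.symm.toEquiv ⟨ψ, hψ.injective⟩ :=
          (map_inv (Equiv.Perm.viaEmbeddingHom ⟨ψ, hψ.injective⟩) φ.toEquiv).symm
        have := continuous_viaEmbedding hψ hφ'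
        rw [← h] at this
        exact this }
  have hf : ∀ t, f (ψ t) = ψ (φ t) := Equiv.Perm.viaEmbedding_apply φ.toEquiv ⟨ψ, hψ.injective⟩
  refine ⟨f, hf, fun x hx => ?_⟩
  by_cases hxr : x ∈ range ψ
  · obtain ⟨t, rfl⟩ := hxr
    rw [hf, hφ t fun h => hx (mem_image_of_mem _ h)]
  · exact Equiv.Perm.viaEmbedding_apply_of_notMem φ.toEquiv ⟨ψ, hψ.injective⟩ x hxr

theorem exists_not_commute_supported {ψ : ℝ → X} (hψ : IsOpenEmbedding ψ) {a b : ℝ} (hab : a < b) :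
    ∃ f g : X ≃ₜ X, (∀ x ∉ ψ '' Ioo a b, f x = x) ∧ (∀ x ∉ ψ '' Ioo a b, g x = x) ∧
      f * g ≠ g * f := by
  obtain ⟨m, hm⟩ := exists_between hab
  obtain ⟨φ, hφ, hφlt⟩ := exists_homeomorph_real_lt (a := a) (b := b)
  obtain ⟨χ, hχ, hχlt⟩ := exists_homeomorph_real_lt (a := m) (b := b)
  obtain ⟨f, hf, hfU⟩ := exists_homeomorph_extension hψ hφ
  obtain ⟨g, hg, hgU⟩ := exists_homeomorph_extension hψ hχ
  refine ⟨f, g, hfU, fun x hx => hgU x fun h =>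
    hx (image_mono (Ioo_subset_Ioo_left hm.1.le) h), fun hcomm => ?_⟩
  -- `g` fixes `ψ m` but not `f (ψ m) = ψ (φ m)`, as `m < φ m < b`.
  have hφm : φ m < b := by
    by_contra! h
    have h1 : φ (φ m) = φ m := hφ _ fun h' => absurd h'.2 (not_lt.2 h)
    exact (hφlt m hm).ne' (φ.injective h1)
  have h1 := DFunLike.congr_fun hcomm (ψ m)
  rw [Homeomorph.mul_apply, Homeomorph.mul_apply, hg, hf, hf, hg, hχ m (by simp)] at h1
  exact (hχlt (φ m) ⟨hφlt m hm, hφm⟩).ne (hψ.injective h1)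

end Extension

/-! ### Neighborhoods of the identity in a Hausdorff group topology -/

section Minimality

variable {X : Type*} [TopologicalSpace X]

theorem map_mem_of_supported {f : X ≃ₜ X} {U : Set X} (hf : ∀ x ∉ U, f x = x) {x : X}
    (hx : x ∈ U) : f x ∈ U := by
  by_contra h
  exact h (by rwa [f.injective (hf _ h)])

theorem conj_mul_comm_of_disjoint_image {f g h : X ≃ₜ X} {U : Set X} (hf : ∀ x ∉ U, f x = x)
    (hg : ∀ x ∉ U, g x = x) (hU : ∀ x ∈ U, h x ∉ U) :
    h * f * h⁻¹ * g = g * (h * f * h⁻¹) := by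
  have hU' : ∀ x ∈ U, h⁻¹ x ∉ U := fun x hx hm => hU _ hm (by simpa using hx)
  have hfix : ∀ x ∈ U, h (f (h⁻¹ x)) = x := fun x hx => by
    rw [hf _ (hU' x hx)]
    simp
  ext x
  simp only [Homeomorph.mul_apply]
  by_cases hx : x ∈ U
  · rw [hfix x hx, hfix _ (map_mem_of_supported hg hx)]
  · rw [hg x hx]
    by_cases hx' : h⁻¹ x ∈ U
    · rw [hg _ (hU _ (map_mem_of_supported hf hx'))]
    · rw [hf _ hx']
      simp [hg x hx]

/-- In a Hausdorff group topology, a homeomorphism close to the identity cannot move a whole arc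
off itself. -/
theorem eventually_exists_map_mem [T2Space X] [TopologicalSpace (X ≃ₜ X)]
    [IsTopologicalGroup (X ≃ₜ X)] [T2Space (X ≃ₜ X)] {ψ : ℝ → X} (hψ : IsOpenEmbedding ψ) {a b : ℝ}
    (hab : a < b) :
    ∀ᶠ h in 𝓝 (1 : X ≃ₜ X), ∃ p ∈ Ioo a b, ∃ q ∈ Ioo a b, h (ψ p) = ψ q := by
  obtain ⟨f, g, hf, hg, hfg⟩ := exists_not_commute_supported hψ hab
  have hopen : IsOpen {h : X ≃ₜ X | h * f * h⁻¹ * g ≠ g * (h * f * h⁻¹)} :=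
    isOpen_ne_fun (by fun_prop) (by fun_prop)
  filter_upwards [hopen.mem_nhds (by simpa using hfg)] with h hh
  by_contra! hcon
  refine hh (conj_mul_comm_of_disjoint_image hf hg ?_)
  rintro _ ⟨p, hp, rfl⟩ ⟨q, hq, hpq⟩
  exact hcon p hp q hq hpq.symm

theorem subset_image_Ioo_of_inter_nonempty [T2Space X] {ψ : ℝ → X} (hψ : IsOpenEmbedding ψ)
    {S : Set X} (hS : IsPreconnected S) {a b : ℝ} (ha : ψ a ∉ S) (hb : ψ b ∉ S)
    (hne : (S ∩ ψ '' Ioo a b).Nonempty) : S ⊆ ψ '' Ioo a b := by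
  refine hS.subset_of_closure_inter_subset (hψ.isOpenMap _ isOpen_Ioo) hne ?_
  rintro x ⟨hx, hxS⟩
  obtain ⟨t, ht, rfl⟩ := closure_minimal (image_mono Ioo_subset_Icc_self)
    (isCompact_Icc.image hψ.continuous).isClosed hx
  refine mem_image_of_mem _ ⟨lt_of_le_of_ne ht.1 ?_, lt_of_le_of_ne ht.2 ?_⟩
  · rintro rfl
    exact ha hxS
  · rintro rfl
    exact hb hxS

/-- A connected set that accumulates at `ψ b`, where `a < b < c`, and avoids `ψ a`, `ψ b` and `ψ c`
lies on one of the two sides of `ψ b` in the arc. -/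
theorem subset_image_Ioo_or_of_mem_closure [T2Space X] {ψ : ℝ → X} (hψ : IsOpenEmbedding ψ)
    {S : Set X} (hS : IsPreconnected S) {a b c : ℝ} (hab : a < b) (hbc : b < c) (ha : ψ a ∉ S)
    (hb : ψ b ∉ S) (hc : ψ c ∉ S) (hcl : ψ b ∈ closure S) :
    S ⊆ ψ '' Ioo a b ∨ S ⊆ ψ '' Ioo b c := by
  obtain ⟨_, ⟨t, ht, rfl⟩, htS⟩ := mem_closure_iff.1 hcl _
    (hψ.isOpenMap _ isOpen_Ioo) (mem_image_of_mem ψ (show b ∈ Ioo a c from ⟨hab, hbc⟩))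
  rcases lt_trichotomy t b with h | rfl | h
  · exact Or.inl (subset_image_Ioo_of_inter_nonempty hψ hS ha hb
      ⟨_, htS, mem_image_of_mem _ ⟨ht.1, h⟩⟩)
  · exact absurd htS hb
  · exact Or.inr (subset_image_Ioo_of_inter_nonempty hψ hS hb hc
      ⟨_, htS, mem_image_of_mem _ ⟨h, ht.2⟩⟩)

/-- If a homeomorphism `h` maps four successive points of an arc, in order, to four successive
points of the same arc, then it maps the part between the two middle points into the part between
their images. Nothing is assumed about the rest of `X`: the outer two points keep the image from
leaving the arc, whether through its ends or around a circle. -/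
theorem image_Ioo_subset_of_four_points [T2Space X] {ψ : ℝ → X} (hψ : IsOpenEmbedding ψ)
    (h : X ≃ₜ X) {p₁ p₂ p₃ p₄ q₁ q₂ q₃ q₄ : ℝ} (hp₁₂ : p₁ < p₂) (hp₂₃ : p₂ < p₃) (hp₃₄ : p₃ < p₄)
    (hq₁₂ : q₁ < q₂) (hq₂₃ : q₂ < q₃) (hq₃₄ : q₃ < q₄) (h₁ : h (ψ p₁) = ψ q₁)
    (h₂ : h (ψ p₂) = ψ q₂) (h₃ : h (ψ p₃) = ψ q₃) (h₄ : h (ψ p₄) = ψ q₄) :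
    (h ∘ ψ) '' Ioo p₂ p₃ ⊆ ψ '' Ioo q₂ q₃ := by
  have hc : Continuous (h ∘ ψ) := h.continuous.comp hψ.continuous
  set S := (h ∘ ψ) '' Ioo p₂ p₃
  have hS : IsPreconnected S := isPreconnected_Ioo.image _ hc.continuousOn
  have havoid : ∀ {p q : ℝ}, h (ψ p) = ψ q → p ∉ Ioo p₂ p₃ → ψ q ∉ S := by
    rintro p q hpq hp ⟨t, ht, hte⟩
    rw [← hpq] at hte
    exact hp (hψ.injective (h.injective hte) ▸ ht)
  have hcl : ∀ {p q : ℝ}, h (ψ p) = ψ q → p ∈ Icc p₂ p₃ → ψ q ∈ closure S := by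
    intro p q hpq hp
    rw [← hpq]
    exact image_closure_subset_closure_image hc
      (mem_image_of_mem _ (by rwa [closure_Ioo hp₂₃.ne]))
  have a₁ := havoid h₁ fun h => lt_asymm h.1 hp₁₂
  have a₂ := havoid h₂ fun h => lt_irrefl _ h.1
  have a₃ := havoid h₃ fun h => lt_irrefl _ h.2
  have a₄ := havoid h₄ fun h => lt_asymm h.2 hp₃₄
  rcases subset_image_Ioo_or_of_mem_closure hψ hS hq₁₂ hq₂₃ a₁ a₂ a₃
    (hcl h₂ (left_mem_Icc.2 hp₂₃.le)) with hl | hl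
  · rcases subset_image_Ioo_or_of_mem_closure hψ hS hq₂₃ hq₃₄ a₂ a₃ a₄
      (hcl h₃ (right_mem_Icc.2 hp₂₃.le)) with hr | hr
    · exact hr
    -- `S` would lie in two disjoint pieces of the arc.
    · exfalso
      obtain ⟨m, hm⟩ := exists_between hp₂₃
      obtain ⟨t, ht, hte⟩ := hl (mem_image_of_mem _ hm)
      obtain ⟨s, hs, hse⟩ := hr (mem_image_of_mem _ hm)
      have := hψ.injective (hte.trans hse.symm)
      linarith [ht.2, hs.1]
  · exact hl

end Minimality

/-- A homeomorphism close to the identity in a Hausdorff group topology moves the points near a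
given point of the one-manifold part only a little. -/
theorem eventually_dist_lt_of_mem_oneManifoldPart {X : Type*} [MetricSpace X]
    [TopologicalSpace (X ≃ₜ X)] [IsTopologicalGroup (X ≃ₜ X)] [T2Space (X ≃ₜ X)] {x : X}
    (hx : x ∈ oneManifoldPart X) {ε : ℝ} (hε : 0 < ε) :
    ∀ᶠ z : (X ≃ₜ X) × X in 𝓝 (1, x), dist (z.1 z.2) z.2 < ε := by
  obtain ⟨ψ, hψ, rfl, hrange⟩ :=
    exists_isOpenEmbedding_real hx (Metric.ball_mem_nhds x (half_pos hε))
  have hV : ψ '' Ioo (-1) 1 ∈ 𝓝 (ψ 0) :=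
    hψ.isOpenMap.image_mem_nhds (Ioo_mem_nhds (by norm_num) (by norm_num))
  rw [nhds_prod_eq]
  filter_upwards [prod_mem_prod
    ((((eventually_exists_map_mem hψ (show (-4 : ℝ) < -3 by norm_num)).and
      (eventually_exists_map_mem hψ (show (-2 : ℝ) < -1 by norm_num))).and
      (eventually_exists_map_mem hψ (show (1 : ℝ) < 2 by norm_num))).and
      (eventually_exists_map_mem hψ (show (3 : ℝ) < 4 by norm_num))) hV]
  rintro ⟨h, _⟩ ⟨⟨⟨⟨⟨p₁, hp₁, q₁, hq₁, h₁⟩, p₂, hp₂, q₂, hq₂, h₂⟩, p₃, hp₃, q₃, hq₃, h₃⟩,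
    p₄, hp₄, q₄, hq₄, h₄⟩, t, ht, rfl⟩
  have hsub := image_Ioo_subset_of_four_points hψ h (by linarith [hp₁.2, hp₂.1])
    (by linarith [hp₂.2, hp₃.1]) (by linarith [hp₃.2, hp₄.1]) (by linarith [hq₁.2, hq₂.1])
    (by linarith [hq₂.2, hq₃.1]) (by linarith [hq₃.2, hq₄.1]) h₁ h₂ h₃ h₄
  have h5 : h (ψ t) ∈ Metric.ball (ψ 0) (ε / 2) := hrange (image_subset_range _ _
    (hsub ⟨t, ⟨hp₂.2.trans ht.1, ht.2.trans hp₃.1⟩, rfl⟩))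
  have h6 : ψ t ∈ Metric.ball (ψ 0) (ε / 2) := hrange (mem_range_self t)
  rw [Metric.mem_ball] at h5 h6
  linarith [dist_triangle_right (h (ψ t)) (ψ t) (ψ 0)]

theorem shrunkenBall_mem_nhds_one {X : Type*} [MetricSpace X] [CompactSpace X]
    [TopologicalSpace (X ≃ₜ X)] [IsTopologicalGroup (X ≃ₜ X)] [T2Space (X ≃ₜ X)] {ε : ℝ}
    (hε : 0 < ε) : shrunkenBall (oneManifoldPart X)ᶜ ε ∈ 𝓝 (1 : X ≃ₜ X) := by
  have hK : IsCompact (Metric.thickening ε (oneManifoldPart X)ᶜ)ᶜ :=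
    Metric.isOpen_thickening.isClosed_compl.isCompact
  have hmove : ∀ᶠ h in 𝓝 (1 : X ≃ₜ X),
      ∀ x ∈ (Metric.thickening ε (oneManifoldPart X)ᶜ)ᶜ, dist (h x) x < ε :=
    hK.eventually_forall_of_forall_eventually fun x hx =>
      eventually_dist_lt_of_mem_oneManifoldPart
        (by_contra fun hxO => hx (Metric.self_subset_thickening hε _ hxO)) hε
  have hinv : Tendsto (fun h : X ≃ₜ X => h⁻¹) (𝓝 1) (𝓝 1) := by
    simpa using (continuous_inv (G := X ≃ₜ X)).tendsto 1
  filter_upwards [hmove, hinv.eventually hmove] with h h1 h2 x hx using ⟨h1 x hx, h2 x hx⟩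

end ShrunkenTopology

/-- `X` with any compatible metric: `H(X)` is the group `X ≃ₜ X` under composition, and
`C_X` is the complement of the one-manifold part of `X`. -/
theorem mainTheorem1 {X : Type*} [MetricSpace X] [CompactSpace X]
    (hO : Dense (ShrunkenTopology.oneManifoldPart X)) :
    ShrunkenTopology.IsMinimumHausdorffGroupTopology
      (ShrunkenTopology.shrunkenTopology (ShrunkenTopology.oneManifoldPart X)ᶜ) := by
  refine ⟨ShrunkenTopology.isHausdorffGroupTopology_shrunkenTopology hO, ?_⟩
  intro σ hσ U hU
  let := σ
  have := hσ.1
  have := hσ.2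
  refine isOpen_iff_mem_nhds.2 fun g hg => ?_
  obtain ⟨δ, hδ, h⟩ := (ShrunkenTopology.sUnion_translates_iff _ U).1 hU g hg
  have ht : Filter.Tendsto (fun k : X ≃ₜ X => g⁻¹ * k) (𝓝 g) (𝓝 1) := by
    simpa using (continuous_const_mul g⁻¹).tendsto g
  filter_upwards [ht (ShrunkenTopology.shrunkenBall_mem_nhds_one hδ)] with k hk
  simpa using h _ hk
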